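/- Let $\mathbb{k}$ be a field and let $H$ be a pointed Hopf algebra over $\mathbb{k}$, i.e. every simple subcoalgebra of $H$ is one-dimensional. Let $\operatorname{corad}(H)$ be the coradical of $H$ (the sum of all simple subcoalgebras), which is a subalgebra of $H$ since $H$ is pointed, and let $H_0\subseteq H_1\subseteq\cdots$ be the coradical filtration, $H_0=\operatorname{corad}(H)$ and $H_{n+1}=\Delta^{-1}(H_0\otimes H+H\otimes H_n)$. Let $\operatorname{gr}_c H=\bigoplus_{n\ge 0}H_n/H_{n-1}$ (with $H_{-1}=0$) be the associated graded Hopf algebra. If $\operatorname{gr}_c H$ is left or right Noetherian (in particular, if it is Noetherian), then $\operatorname{corad}(H)$, $\operatorname{gr}_c H$ and $H$ are all affine, i.e. finitely generated as $\mathbb{k}$-algebras. -/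

import Mathlib

open Coalgebra TensorProduct DirectSum

section Coalgebras

variable (k : Type*) {C : Type*} [Field k] [AddCommGroup C] [Module k C] [Coalgebra k C]

/-- A subcoalgebra: a subspace `D` with `Δ(D) ⊆ D ⊗ D`. -/
def IsSubcoalgebra (D : Submodule k C) : Prop :=
  ∀ x ∈ D, comul (R := k) x ∈ LinearMap.range (TensorProduct.map D.subtype D.subtype)

/-- A simple subcoalgebra: a nonzero subcoalgebra with no subcoalgebras but zero and itself. -/
structure IsSimpleSubcoalgebra (D : Submodule k C) : Prop where
  isSubcoalgebra : IsSubcoalgebra k D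
  ne_bot : D ≠ ⊥
  eq_bot_or_eq : ∀ E : Submodule k C, IsSubcoalgebra k E → E ≤ D → E = ⊥ ∨ E = D

variable (C)

/-- The coradical: the sum of all simple subcoalgebras. -/
def coradical : Submodule k C := sSup {D | IsSimpleSubcoalgebra k D}

/-- A coalgebra is pointed if every simple subcoalgebra is one-dimensional. -/
class IsPointedCoalgebra : Prop where
  finrank_eq_one : ∀ D : Submodule k C, IsSimpleSubcoalgebra k D → Module.finrank k D = 1

variable {C} in
/-- The wedge `X ∧ Y = Δ⁻¹(X ⊗ C + C ⊗ Y)` of two subspaces. -/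
def coalgebraWedge (X Y : Submodule k C) : Submodule k C :=
  (LinearMap.range (X.subtype.rTensor C) ⊔ LinearMap.range (Y.subtype.lTensor C)).comap
    (comul (R := k) (A := C))

/-- The coradical filtration: `C₀` is the coradical, and `Cₙ₊₁ = C₀ ∧ Cₙ`. -/
def coradicalFiltration : ℕ → Submodule k C
  | 0 => coradical k C
  | n + 1 => coalgebraWedge k (coradical k C) (coradicalFiltration n)

end Coalgebras

/-- The filtration `F` shifted by one: `0, F₀, F₁, …`. -/
def shiftFiltration {k A : Type*} [Field k] [AddCommGroup A] [Module k A]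
    (F : ℕ → Submodule k A) : ℕ → Submodule k A
  | 0 => ⊥
  | n + 1 => F n

section AssociatedGraded

variable {k A : Type*} [Field k] [Ring A] [Algebra k A]
  (F : ℕ → Submodule k A)

/-- The homogeneous component `Fₙ / Fₙ₋₁` (with `F₋₁ = 0`). -/
def GradedPiece (n : ℕ) : Type _ := F n ⧸ (shiftFiltration F n).submoduleOf (F n)

instance GradedPiece.addCommGroup (n : ℕ) : AddCommGroup (GradedPiece F n) :=
  inferInstanceAs (AddCommGroup (F n ⧸ (shiftFiltration F n).submoduleOf (F n)))

instance GradedPiece.module (n : ℕ) : Module k (GradedPiece F n) :=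
  inferInstanceAs (Module k (F n ⧸ (shiftFiltration F n).submoduleOf (F n)))

variable {F}

/-- The class in `Fₙ / Fₙ₋₁` of an element of `Fₙ`. -/
def GradedPiece.mk (n : ℕ) (x : F n) : GradedPiece F n :=
  Submodule.Quotient.mk (p := (shiftFiltration F n).submoduleOf (F n)) x

theorem GradedPiece.mk_eq_mk {n : ℕ} {x y : F n} :
    GradedPiece.mk n x = GradedPiece.mk n y ↔ (x - y : A) ∈ shiftFiltration F n :=
  Submodule.Quotient.eq _

theorem GradedPiece.sigma_ext {i j : ℕ} (h : i = j) {x : F i} {y : F j} (hxy : (x : A) = y) :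
    GradedMonoid.mk (A := GradedPiece F) i (GradedPiece.mk i x) =
      GradedMonoid.mk j (GradedPiece.mk j y) := by
  subst h
  obtain rfl : x = y := Subtype.ext hxy
  rfl

variable [SetLike.GradedMonoid F]

theorem mul_mem_shift_left {i j : ℕ} {x y : A} (hx : x ∈ shiftFiltration F i) (hy : y ∈ F j) :
    x * y ∈ shiftFiltration F (i + j) := by
  cases i with
  | zero =>
    obtain rfl : x = 0 := by simpa [shiftFiltration] using hx
    simp
  | succ i =>
    rw [Nat.succ_add]
    exact SetLike.mul_mem_graded (A := F) hx hy

theorem mul_mem_shift_right {i j : ℕ} {x y : A} (hx : x ∈ F i) (hy : y ∈ shiftFiltration F j) :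
    x * y ∈ shiftFiltration F (i + j) := by
  cases j with
  | zero =>
    obtain rfl : y = 0 := by simpa [shiftFiltration] using hy
    simp
  | succ j => exact SetLike.mul_mem_graded (A := F) hx hy

/-- The product `Fᵢ/Fᵢ₋₁ × Fⱼ/Fⱼ₋₁ → Fᵢ₊ⱼ/Fᵢ₊ⱼ₋₁` induced by the product of `A`. -/
def GradedPiece.mul {i j : ℕ} : GradedPiece F i → GradedPiece F j → GradedPiece F (i + j) :=
  Quotient.map₂ (fun x y => ⟨(x : A) * y, SetLike.mul_mem_graded x.2 y.2⟩) (by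
    intro a a' ha b b' hb
    replace ha : (a - a' : A) ∈ shiftFiltration F i :=
      (Submodule.quotientRel_def ((shiftFiltration F i).submoduleOf (F i))).mp ha
    replace hb : (b - b' : A) ∈ shiftFiltration F j :=
      (Submodule.quotientRel_def ((shiftFiltration F j).submoduleOf (F j))).mp hb
    refine (Submodule.quotientRel_def _).mpr ?_
    change (a * b - a' * b' : A) ∈ shiftFiltration F (i + j)
    have : (a * b - a' * b' : A) = (a - a') * b + a' * (b - b') := by noncomm_ring
    rw [this]
    exact add_mem (mul_mem_shift_left ha b.2) (mul_mem_shift_right a'.2 hb))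

theorem GradedPiece.mk_mul_mk {i j : ℕ} (x : F i) (y : F j) :
    GradedPiece.mul (GradedPiece.mk i x) (GradedPiece.mk j y) =
      GradedPiece.mk (i + j) ⟨(x : A) * y, SetLike.mul_mem_graded x.2 y.2⟩ := rfl

instance GradedPiece.gOne : GradedMonoid.GOne (GradedPiece F) where
  one := GradedPiece.mk 0 ⟨1, SetLike.one_mem_graded F⟩

instance GradedPiece.gMul : GradedMonoid.GMul (GradedPiece F) where
  mul := GradedPiece.mul

instance GradedPiece.gRing : DirectSum.GRing (GradedPiece F) where
  mul_zero := by
    rintro i j ⟨a⟩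
    exact congrArg (GradedPiece.mk (i + j)) (Subtype.ext (mul_zero (a : A)))
  zero_mul := by
    rintro i j ⟨a⟩
    exact congrArg (GradedPiece.mk (i + j)) (Subtype.ext (zero_mul (a : A)))
  mul_add := by
    rintro i j ⟨a⟩ ⟨b⟩ ⟨c⟩
    exact congrArg (GradedPiece.mk (i + j)) (Subtype.ext (mul_add (a : A) b c))
  add_mul := by
    rintro i j ⟨a⟩ ⟨b⟩ ⟨c⟩
    exact congrArg (GradedPiece.mk (i + j)) (Subtype.ext (add_mul (a : A) b c))
  one_mul := by
    rintro ⟨i, ⟨a⟩⟩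
    exact GradedPiece.sigma_ext (zero_add i) (one_mul (a : A))
  mul_one := by
    rintro ⟨i, ⟨a⟩⟩
    exact GradedPiece.sigma_ext (add_zero i) (mul_one (a : A))
  mul_assoc := by
    rintro ⟨i, ⟨a⟩⟩ ⟨j, ⟨b⟩⟩ ⟨l, ⟨c⟩⟩
    exact GradedPiece.sigma_ext (add_assoc i j l) (mul_assoc (a : A) b c)
  natCast n := GradedPiece.mk 0 (n • ⟨1, SetLike.one_mem_graded F⟩)
  natCast_zero := by rw [zero_smul]; rfl
  natCast_succ n := by rw [succ_nsmul]; rfl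
  intCast n := GradedPiece.mk 0 (n • ⟨1, SetLike.one_mem_graded F⟩)
  intCast_ofNat n := by rw [natCast_zsmul]
  intCast_negSucc_ofNat n := by rw [negSucc_zsmul]; rfl

instance GradedPiece.gAlgebra : DirectSum.GAlgebra k (GradedPiece F) where
  toFun :=
    { toFun := fun r => GradedPiece.mk 0 (r • ⟨1, SetLike.one_mem_graded F⟩)
      map_zero' := by rw [zero_smul]; rfl
      map_add' := fun r s => by rw [add_smul]; rfl }
  map_one := by
    change GradedPiece.mk 0 ((1 : k) • _) = _
    rw [one_smul]; rfl
  map_mul r s := GradedPiece.sigma_ext rfl (by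
    change (r * s) • (1 : A) = (r • (1 : A)) * (s • (1 : A))
    rw [smul_mul_smul_comm, mul_one])
  commutes := by
    rintro r ⟨i, ⟨a⟩⟩
    exact GradedPiece.sigma_ext (add_comm 0 i) (by
      change (r • (1 : A)) * a = a * (r • (1 : A))
      simp)
  smul_def := by
    rintro r ⟨i, ⟨a⟩⟩
    exact GradedPiece.sigma_ext (zero_add i).symm (by
      change r • (a : A) = (r • (1 : A)) * a
      simp)

end AssociatedGraded

section CoradicalFiltrationLemmas

variable {k C : Type*} [Field k] [AddCommGroup C] [Module k C]

theorem range_map_mono {X X' Y Y' : Submodule k C} (hX : X ≤ X') (hY : Y ≤ Y') :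
    LinearMap.range (TensorProduct.map X.subtype Y.subtype) ≤
      LinearMap.range (TensorProduct.map X'.subtype Y'.subtype) := by
  rw [← Submodule.subtype_comp_inclusion X X' hX, ← Submodule.subtype_comp_inclusion Y Y' hY,
    TensorProduct.map_comp]
  exact LinearMap.range_comp_le_range _ _

theorem range_map_le_lTensor (X Y : Submodule k C) :
    LinearMap.range (TensorProduct.map X.subtype Y.subtype) ≤
      LinearMap.range (Y.subtype.lTensor C) := by
  rw [← LinearMap.lTensor_comp_rTensor]
  exact LinearMap.range_comp_le_range _ _

theorem range_map_le_rTensor (X Y : Submodule k C) :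
    LinearMap.range (TensorProduct.map X.subtype Y.subtype) ≤
      LinearMap.range (X.subtype.rTensor C) := by
  rw [← LinearMap.rTensor_comp_lTensor]
  exact LinearMap.range_comp_le_range _ _

theorem range_lTensor_eq_ker (M : Type*) [AddCommGroup M] [Module k M] (Y : Submodule k C) :
    LinearMap.range (Y.subtype.lTensor M) = LinearMap.ker (Y.mkQ.lTensor M) :=
  (LinearMap.exact_iff.mp
    (lTensor_exact M (LinearMap.exact_subtype_mkQ Y) Y.mkQ_surjective)).symm

theorem range_rTensor_inf_range_lTensor (X Y : Submodule k C) :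
    LinearMap.range (X.subtype.rTensor C) ⊓ LinearMap.range (Y.subtype.lTensor C) ≤
      LinearMap.range (TensorProduct.map X.subtype Y.subtype) := by
  rintro _ ⟨⟨w, rfl⟩, hz⟩
  rw [SetLike.mem_coe, range_lTensor_eq_ker, LinearMap.mem_ker, ← LinearMap.comp_apply,
    LinearMap.lTensor_comp_rTensor, ← LinearMap.rTensor_comp_lTensor, LinearMap.comp_apply] at hz
  have hw : w ∈ LinearMap.ker (Y.mkQ.lTensor X) :=
    Module.Flat.rTensor_preserves_injective_linearMap (M := C ⧸ Y) X.subtype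
      X.injective_subtype (hz.trans (map_zero _).symm)
  rw [← range_lTensor_eq_ker] at hw
  obtain ⟨v, rfl⟩ := hw
  refine ⟨v, ?_⟩
  rw [← LinearMap.comp_apply, LinearMap.rTensor_comp_lTensor]

variable [Coalgebra k C]

theorem isSubcoalgebra_coradical : IsSubcoalgebra k (coradical k C) := by
  suffices h : coradical k C ≤ Submodule.comap (comul (R := k) (A := C))
      (LinearMap.range (TensorProduct.map (coradical k C).subtype (coradical k C).subtype)) from
    fun x hx => h hx
  refine sSup_le fun D hD x hx => ?_
  exact range_map_mono (le_sSup hD) (le_sSup hD) (hD.isSubcoalgebra x hx)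

theorem coalgebraWedge_eq_ker (X Y : Submodule k C) :
    coalgebraWedge k X Y = LinearMap.ker (TensorProduct.map X.mkQ Y.mkQ ∘ₗ comul) := by
  rw [LinearMap.ker_comp, TensorProduct.map_ker (LinearMap.exact_subtype_mkQ X) X.mkQ_surjective
      (LinearMap.exact_subtype_mkQ Y) Y.mkQ_surjective, sup_comm]
  rfl

/-- If `Δ(X) ⊆ C ⊗ X`, then `Δ(X ∧ Y) ⊆ C ⊗ (X ∧ Y)`. -/
theorem comul_mem_of_mem_wedge {X Y : Submodule k C}
    (hX : ∀ x ∈ X, comul (R := k) x ∈ LinearMap.range (X.subtype.lTensor C))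
    {x : C} (hx : x ∈ coalgebraWedge k X Y) :
    comul (R := k) x ∈ LinearMap.range ((coalgebraWedge k X Y).subtype.lTensor C) := by
  have hker : LinearMap.range ((coalgebraWedge k X Y).subtype.lTensor C) =
      LinearMap.ker ((TensorProduct.map X.mkQ Y.mkQ ∘ₗ comul (R := k) (A := C)).lTensor C) := by
    rw [coalgebraWedge_eq_ker]
    exact (LinearMap.exact_iff.mp (Module.Flat.lTensor_exact C
      (LinearMap.exact_subtype_ker_map _))).symm
  rw [hker, LinearMap.mem_ker, LinearMap.lTensor_comp, LinearMap.comp_apply]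
  have hco := Coalgebra.coassoc_apply (R := k) x
  rw [← hco]
  have hcomp : (TensorProduct.map X.mkQ Y.mkQ).lTensor C ∘ₗ
      (TensorProduct.assoc k C C C).toLinearMap ∘ₗ (comul (R := k) (A := C)).rTensor C =
      (TensorProduct.assoc k C (C ⧸ X) (C ⧸ Y)).toLinearMap ∘ₗ
        TensorProduct.map (X.mkQ.lTensor C ∘ₗ comul) Y.mkQ := by
    refine TensorProduct.ext' fun a b => ?_
    simp only [LinearMap.comp_apply, LinearMap.rTensor_tmul, TensorProduct.map_tmul]
    induction comul (R := k) a with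
    | zero => simp
    | tmul u v => simp
    | add u v hu hv => simp only [TensorProduct.add_tmul, map_add, hu, hv]
  have h1 := LinearMap.congr_fun hcomp (comul x)
  simp only [LinearMap.comp_apply] at h1
  refine h1.trans ?_
  suffices TensorProduct.map (X.mkQ.lTensor C ∘ₗ comul) Y.mkQ (comul (R := k) x) = 0 by
    rw [this, map_zero]
  rw [← LinearMap.mem_ker]
  have hx' : comul (R := k) x ∈
      LinearMap.range (X.subtype.rTensor C) ⊔ LinearMap.range (Y.subtype.lTensor C) := hx
  refine (sup_le ?_ ?_ : _ ≤ LinearMap.ker _) hx'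
  · rw [LinearMap.range_le_ker_iff]
    refine TensorProduct.ext' fun a b => ?_
    have ha := hX a a.2
    rw [range_lTensor_eq_ker, LinearMap.mem_ker] at ha
    simp [ha]
  · rw [LinearMap.range_le_ker_iff]
    refine TensorProduct.ext' fun a b => ?_
    have hb : Y.mkQ (b : C) = 0 := (Submodule.Quotient.mk_eq_zero Y).mpr b.2
    simp only [LinearMap.comp_apply, LinearMap.lTensor_tmul, Submodule.subtype_apply,
      TensorProduct.map_tmul, hb, TensorProduct.tmul_zero, LinearMap.zero_apply]

theorem comul_mem_lTensor_coradicalFiltration (n : ℕ) {x : C}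
    (hx : x ∈ coradicalFiltration k C n) :
    comul (R := k) x ∈ LinearMap.range ((coradicalFiltration k C n).subtype.lTensor C) := by
  cases n with
  | zero => exact range_map_le_lTensor _ _ (isSubcoalgebra_coradical x hx)
  | succ n =>
    exact comul_mem_of_mem_wedge
      (fun x hx => range_map_le_lTensor _ _ (isSubcoalgebra_coradical x hx)) hx

theorem shift_le_coradicalFiltration (n : ℕ) :
    shiftFiltration (coradicalFiltration k C) n ≤ coradicalFiltration k C n := by
  cases n with
  | zero => exact bot_le
  | succ n =>
    intro x hx
    exact Submodule.mem_sup_right (comul_mem_lTensor_coradicalFiltration n hx)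

theorem comul_mem_of_mem_coradicalFiltration (n : ℕ) {x : C}
    (hx : x ∈ coradicalFiltration k C n) :
    comul (R := k) x ∈
      LinearMap.range (TensorProduct.map (coradical k C).subtype
        (coradicalFiltration k C n).subtype) ⊔
      LinearMap.range ((shiftFiltration (coradicalFiltration k C) n).subtype.lTensor C) := by
  cases n with
  | zero => exact Submodule.mem_sup_left (isSubcoalgebra_coradical x hx)
  | succ n =>
    have h1 := comul_mem_lTensor_coradicalFiltration (n + 1) hx
    have h2 : comul (R := k) x ∈ LinearMap.range ((coradical k C).subtype.rTensor C) ⊔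
      LinearMap.range ((coradicalFiltration k C n).subtype.lTensor C) := hx
    obtain ⟨a, ha, b, hb, hab⟩ := Submodule.mem_sup.mp h2
    have hle : LinearMap.range ((coradicalFiltration k C n).subtype.lTensor C) ≤
        LinearMap.range ((coradicalFiltration k C (n + 1)).subtype.lTensor C) := by
      have h : coradicalFiltration k C n ≤ coradicalFiltration k C (n + 1) :=
        shift_le_coradicalFiltration (n + 1)
      rw [← Submodule.subtype_comp_inclusion _ _ h, LinearMap.lTensor_comp]
      exact LinearMap.range_comp_le_range _ _
    have ha' : a ∈ LinearMap.range ((coradicalFiltration k C (n + 1)).subtype.lTensor C) := by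
      rw [eq_sub_of_add_eq hab]
      exact sub_mem h1 (hle hb)
    exact Submodule.mem_sup.mpr
      ⟨a, range_rTensor_inf_range_lTensor _ _ ⟨ha, ha'⟩, b, hb, hab⟩

theorem mem_coradicalFiltration_of_comul_mem (n : ℕ) {x : C}
    (hx : comul (R := k) x ∈ LinearMap.range ((coradical k C).subtype.rTensor C) ⊔
      LinearMap.range ((shiftFiltration (coradicalFiltration k C) n).subtype.lTensor C)) :
    x ∈ coradicalFiltration k C n := by
  cases n with
  | zero =>
    have h : LinearMap.range ((coradical k C).subtype.rTensor C) ⊔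
      LinearMap.range ((shiftFiltration (coradicalFiltration k C) 0).subtype.lTensor C) ≤
      Submodule.comap ((TensorProduct.rid k C).toLinearMap ∘ₗ
        (counit (R := k) (A := C)).lTensor C) (coradical k C) := by
      refine sup_le ?_ ?_
      · rintro _ ⟨w, rfl⟩
        induction w with
        | zero => simp
        | tmul a b => simpa using Submodule.smul_mem _ _ a.2
        | add u v hu hv => rw [map_add]; exact add_mem hu hv
      · rintro _ ⟨w, rfl⟩
        induction w with
        | zero => simp
        | tmul a b =>
          have : (b : C) = 0 := by simpa [shiftFiltration] using b.2
          simp [this]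
        | add u v hu hv => rw [map_add]; exact add_mem hu hv
    have := h hx
    simpa [coradicalFiltration] using this
  | succ n => exact hx

end CoradicalFiltrationLemmas

section PointedHopf

variable {k H : Type*} [Field k] [Ring H] [HopfAlgebra k H]

theorem IsGroupLikeElem.mem_coradical {g : H} (hg : IsGroupLikeElem k g) : g ∈ coradical k H := by
  refine (le_sSup ?_ : k ∙ g ≤ coradical k H) (Submodule.mem_span_singleton_self g)
  refine ⟨fun x hx => ?_, ?_, fun E _ hE => ?_⟩
  · obtain ⟨c, rfl⟩ := Submodule.mem_span_singleton.mp hx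
    refine ⟨c • (⟨g, Submodule.mem_span_singleton_self g⟩ ⊗ₜ
      ⟨g, Submodule.mem_span_singleton_self g⟩), ?_⟩
    simp [hg.comul_eq_tmul_self]
  · simpa using hg.ne_zero
  · exact (nonzero_span_atom g hg.ne_zero).le_iff.mp hE

theorem one_mem_coradical : (1 : H) ∈ coradical k H :=
  IsGroupLikeElem.mem_coradical IsGroupLikeElem.one

theorem map_mul_map_mem {M N M' N' : Type*} [AddCommGroup M] [Module k M] [AddCommGroup N]
    [Module k N] [AddCommGroup M'] [Module k M'] [AddCommGroup N'] [Module k N']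
    (f : M →ₗ[k] H) (g : N →ₗ[k] H) (f' : M' →ₗ[k] H) (g' : N' →ₗ[k] H)
    (S : Submodule k (H ⊗[k] H))
    (h : ∀ a b c d, (f a * f' c) ⊗ₜ[k] (g b * g' d) ∈ S) (u : M ⊗[k] N) (v : M' ⊗[k] N') :
    TensorProduct.map f g u * TensorProduct.map f' g' v ∈ S := by
  induction u with
  | zero => simp
  | add p q hp hq => rw [map_add, add_mul]; exact add_mem hp hq
  | tmul a b =>
    induction v with
    | zero => simp
    | add p q hp hq => rw [map_add, mul_add]; exact add_mem hp hq
    | tmul c d => simpa using h a b c d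

variable [IsPointedCoalgebra k H]

theorem coradical_eq_span_groupLike :
    coradical k H = Submodule.span k {g : H | IsGroupLikeElem k g} := by
  refine le_antisymm (sSup_le fun D hD => ?_) (Submodule.span_le.mpr fun g hg => hg.mem_coradical)
  obtain ⟨⟨v, hvD⟩, hv0, hv⟩ := finrank_eq_one_iff'.mp (IsPointedCoalgebra.finrank_eq_one D hD)
  have hv0 : v ≠ 0 := fun h => hv0 (Subtype.ext h)
  have hspan : ∀ w ∈ D, ∃ c : k, c • v = w := fun w hw => by
    obtain ⟨c, hc⟩ := hv ⟨w, hw⟩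
    exact ⟨c, congrArg Subtype.val hc⟩
  have hc : ∃ c : k, comul (R := k) v = c • (v ⊗ₜ[k] v) := by
    obtain ⟨w, hw⟩ := hD.isSubcoalgebra v hvD
    rw [← hw]
    clear hw
    induction w with
    | zero => exact ⟨0, by simp⟩
    | tmul a b =>
      obtain ⟨c, hc⟩ := hspan a a.2
      obtain ⟨d, hd⟩ := hspan b b.2
      refine ⟨c * d, ?_⟩
      simp [← hc, ← hd, TensorProduct.smul_tmul', TensorProduct.tmul_smul, mul_smul, smul_comm c d]
    | add u w hu hw =>
      obtain ⟨c, hc⟩ := hu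
      obtain ⟨d, hd⟩ := hw
      exact ⟨c + d, by rw [map_add, hc, hd, add_smul]⟩
  obtain ⟨c, hc⟩ := hc
  have hcounit : c * counit (R := k) v = 1 := by
    have h := Coalgebra.rTensor_counit_comul (R := k) v
    rw [hc] at h
    have h2 := congrArg (TensorProduct.lid k H) h
    simp only [map_smul, LinearMap.rTensor_tmul, TensorProduct.lid_tmul, one_smul] at h2
    rw [smul_smul] at h2
    have h3 : (c * counit (R := k) v - 1) • v = 0 := by rw [sub_smul, h2, one_smul, sub_self]
    exact sub_eq_zero.mp ((smul_eq_zero.mp h3).resolve_right hv0)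
  have hg : IsGroupLikeElem k (c • v) := by
    refine ⟨by simpa using hcounit, ?_⟩
    rw [map_smul, hc, TensorProduct.smul_tmul', TensorProduct.tmul_smul, TensorProduct.smul_tmul']
  have hc0 : c ≠ 0 := fun h => by simp [h] at hcounit
  intro w hw
  obtain ⟨d, rfl⟩ := hspan w hw
  have : d • v = (d * c⁻¹) • (c • v) := by rw [smul_smul, mul_assoc, inv_mul_cancel₀ hc0, mul_one]
  rw [this]
  exact Submodule.smul_mem _ _ (Submodule.subset_span hg)

theorem mul_mem_coradical {x y : H} (hx : x ∈ coradical k H) (hy : y ∈ coradical k H) :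
    x * y ∈ coradical k H := by
  have h := Submodule.mul_mem_mul hx hy
  rw [coradical_eq_span_groupLike, Submodule.span_mul_span] at h
  refine Submodule.span_le.mpr ?_ h
  rintro _ ⟨a, ha, b, hb, rfl⟩
  exact IsGroupLikeElem.mem_coradical (IsGroupLikeElem.mul ha hb)

variable (k H) in
/-- The coradical of a pointed Hopf algebra, as a subalgebra. -/
def coradicalSubalgebra : Subalgebra k H :=
  (coradical k H).toSubalgebra one_mem_coradical fun _ _ hx hy => mul_mem_coradical hx hy

theorem mul_mem_coradicalFiltration (s : ℕ) : ∀ i j : ℕ, i + j = s → ∀ x y : H,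
    x ∈ coradicalFiltration k H i → y ∈ coradicalFiltration k H j →
      x * y ∈ coradicalFiltration k H s := by
  induction s using Nat.strong_induction_on with
  | _ s ih =>
  intro i j hij x y hx hy
  have hL : ∀ a ∈ shiftFiltration (coradicalFiltration k H) i, ∀ b ∈ coradicalFiltration k H j,
      a * b ∈ shiftFiltration (coradicalFiltration k H) s := by
    intro a ha b hb
    cases i with
    | zero =>
      obtain rfl : a = 0 := by simpa [shiftFiltration] using ha
      simp
    | succ i =>
      obtain rfl : s = (i + j) + 1 := by omega
      exact ih (i + j) (by omega) i j rfl a b ha hb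
  have hR : ∀ a ∈ coradicalFiltration k H i, ∀ b ∈ shiftFiltration (coradicalFiltration k H) j,
      a * b ∈ shiftFiltration (coradicalFiltration k H) s := by
    intro a ha b hb
    cases j with
    | zero =>
      obtain rfl : b = 0 := by simpa [shiftFiltration] using hb
      simp
    | succ j =>
      obtain rfl : s = (i + j) + 1 := by omega
      exact ih (i + j) (by omega) i j rfl a b ha hb
  apply mem_coradicalFiltration_of_comul_mem
  rw [Bialgebra.comul_mul]
  have hl : ∀ (a b : H), b ∈ shiftFiltration (coradicalFiltration k H) s →
      a ⊗ₜ[k] b ∈ LinearMap.range ((coradical k H).subtype.rTensor H) ⊔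
        LinearMap.range ((shiftFiltration (coradicalFiltration k H) s).subtype.lTensor H) :=
    fun a b hb => Submodule.mem_sup_right ⟨a ⊗ₜ ⟨b, hb⟩, rfl⟩
  have hr : ∀ (a b : H), a ∈ coradical k H →
      a ⊗ₜ[k] b ∈ LinearMap.range ((coradical k H).subtype.rTensor H) ⊔
        LinearMap.range ((shiftFiltration (coradicalFiltration k H) s).subtype.lTensor H) :=
    fun a b ha => Submodule.mem_sup_left ⟨⟨a, ha⟩ ⊗ₜ b, rfl⟩
  obtain ⟨_, ⟨u, rfl⟩, _, ⟨v, rfl⟩, huv⟩ :=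
    Submodule.mem_sup.mp (comul_mem_of_mem_coradicalFiltration i hx)
  obtain ⟨_, ⟨u', rfl⟩, _, ⟨v', rfl⟩, huv'⟩ :=
    Submodule.mem_sup.mp (comul_mem_of_mem_coradicalFiltration j hy)
  generalize LinearMap.range ((coradical k H).subtype.rTensor H) ⊔
    LinearMap.range ((shiftFiltration (coradicalFiltration k H) s).subtype.lTensor H) = S at hl hr ⊢
  rw [← huv, ← huv', add_mul, mul_add, mul_add]
  unfold LinearMap.lTensor
  refine add_mem (add_mem ?_ ?_) (add_mem ?_ ?_) <;>
    refine map_mul_map_mem _ _ _ _ _ (fun a b c d => ?_) _ _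
  · exact hr _ _ (mul_mem_coradical a.2 c.2)
  · exact hl _ _ (hR _ b.2 _ d.2)
  · exact hl _ _ (hL _ b.2 _ d.2)
  · exact hl _ _ (hL _ b.2 _ (shift_le_coradicalFiltration j d.2))

instance coradicalFiltration.gradedMonoid :
    SetLike.GradedMonoid (coradicalFiltration k H) where
  one_mem := one_mem_coradical
  mul_mem i j x y hx hy := mul_mem_coradicalFiltration (i + j) i j rfl x y hx hy

variable (k H) in
/-- The underlying algebra of the graded Hopf algebra `gr_c H = ⨁ₙ Hₙ/Hₙ₋₁` associated to the
coradical filtration of a pointed Hopf algebra. -/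
abbrev coradicalGraded : Type _ := ⨁ n, GradedPiece (coradicalFiltration k H) n

end PointedHopf

/-!
The degree zero part of `gr_c H` is the coradical, so `corad H` is a quotient of `gr_c H` and hence
left or right Noetherian. It is the group algebra of the group of group-like elements, and a group
with a Noetherian group algebra is finitely generated, so `corad H` is affine. A graded algebra is
generated by its degree zero part together with the homogeneous components of finitely many
generators of its irrelevant ideal, and lifts of generators of `gr_c H` generate `H`, because the
coradical filtration is exhaustive: a finite-dimensional subcoalgebra `E` has Artinian dual algebra,
whose Jacobson radical is nilpotent and contains the restrictions to `E` of the forms vanishing on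
the coradical.
-/

/-- A ring satisfying the ascending chain condition on left ideals or on right ideals. -/
def IsLeftOrRightNoetherian (R : Type*) [Ring R] : Prop :=
  IsNoetherianRing R ∨ IsNoetherianRing Rᵐᵒᵖ

namespace IsLeftOrRightNoetherian

variable {R S : Type*} [Ring R] [Ring S]

theorem of_surjective (hR : IsLeftOrRightNoetherian R) (f : R →+* S)
    (hf : Function.Surjective f) : IsLeftOrRightNoetherian S :=
  hR.imp (fun hR => isNoetherianRing_of_surjective R S f hf (H := hR)) fun hR =>
    isNoetherianRing_of_surjective Rᵐᵒᵖ Sᵐᵒᵖ f.op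
      (MulOpposite.op_surjective.comp (hf.comp MulOpposite.unop_surjective)) (H := hR)

open scoped Pointwise in
theorem exists_finite_ker_subset_closure (hR : IsLeftOrRightNoetherian R) (f : R →+* S) :
    ∃ s : Set R, s.Finite ∧ (∀ x ∈ s, f x = 0) ∧
      ∀ a, f a = 0 → a ∈ AddSubmonoid.closure (Set.univ * s ∪ s * Set.univ) := by
  rcases hR with hR | hR
  · obtain ⟨s, hs⟩ := IsNoetherian.noetherian (RingHom.ker f)
    refine ⟨s, s.finite_toSet, fun x hx => hs.le (Submodule.subset_span hx), fun a ha => ?_⟩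
    replace ha : a ∈ Submodule.span R (s : Set R) := hs.ge ha
    induction ha using Submodule.closure_induction with
    | zero => exact zero_mem _
    | add x y _ _ hx hy => exact add_mem hx hy
    | smul_mem r x hx =>
      exact AddSubmonoid.subset_closure (Or.inl (Set.mul_mem_mul (Set.mem_univ r) hx))
  · obtain ⟨s, hs⟩ := IsNoetherian.noetherian (RingHom.ker f.op)
    refine ⟨MulOpposite.op ⁻¹' s, s.finite_toSet.preimage MulOpposite.op_injective.injOn,
      fun x hx => MulOpposite.op_injective (hs.le (Submodule.subset_span hx)), fun a ha => ?_⟩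
    suffices ∀ x ∈ Submodule.span Rᵐᵒᵖ (s : Set Rᵐᵒᵖ), x.unop ∈ AddSubmonoid.closure
        (Set.univ * MulOpposite.op ⁻¹' (s : Set Rᵐᵒᵖ) ∪ MulOpposite.op ⁻¹' s * Set.univ) from
      this (.op a) (hs.ge (congrArg MulOpposite.op ha))
    intro x hx
    induction hx using Submodule.closure_induction with
    | zero => exact zero_mem _
    | add x y _ _ hx hy => exact add_mem hx hy
    | smul_mem r x hx =>
      exact AddSubmonoid.subset_closure
        (Or.inr (Set.mul_mem_mul (show x.unop ∈ _ from hx) (Set.mem_univ r.unop)))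

end IsLeftOrRightNoetherian

section GroupRing

open MonoidAlgebra

variable {R G : Type*} [Ring R] [Group G]

theorem monoidAlgebra_mapDomain_sub {X Y : Type*} (f : X → Y) (x y : MonoidAlgebra R X) :
    mapDomain f (x - y) = mapDomain f x - mapDomain f y := by
  rw [eq_sub_iff_add_eq, ← mapDomain_add, sub_add_cancel]

theorem mapDomain_quotientMk_mul_single {K : Subgroup G} {g : G} (hg : g ∈ K)
    (x : MonoidAlgebra R G) :
    mapDomain (QuotientGroup.mk : G → G ⧸ K) (x * single g 1) = mapDomain QuotientGroup.mk x := by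
  induction x using MonoidAlgebra.induction_linear with
  | zero => rw [zero_mul]
  | add x y hx hy => rw [add_mul, mapDomain_add, mapDomain_add, hx, hy]
  | single h r =>
    rw [single_mul_single, mapDomain_single, mapDomain_single, mul_one,
      QuotientGroup.mk_mul_of_mem h hg]

theorem mapDomain_quotientMk_eq_zero_of_mem_span {K : Subgroup G} {s : Set (MonoidAlgebra R G)}
    (hs : ∀ x ∈ s, ∃ g ∈ K, x = single g 1 - 1) {x : MonoidAlgebra R G}
    (hx : x ∈ Submodule.span (MonoidAlgebra R G) s) :
    mapDomain (QuotientGroup.mk : G → G ⧸ K) x = 0 := by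
  induction hx using Submodule.closure_induction with
  | zero => exact mapDomain_zero _
  | add x y _ _ hx hy => rw [mapDomain_add, hx, hy, add_zero]
  | smul_mem a x hx =>
    obtain ⟨g, hg, rfl⟩ := hs x hx
    rw [smul_eq_mul, mul_sub, mul_one, monoidAlgebra_mapDomain_sub,
      mapDomain_quotientMk_mul_single hg, sub_self]

theorem mem_of_single_sub_one_mem_span [Nontrivial R] {K : Subgroup G}
    {s : Set (MonoidAlgebra R G)} (hs : ∀ x ∈ s, ∃ g ∈ K, x = single g 1 - 1) {g : G}
    (hg : single g 1 - 1 ∈ Submodule.span (MonoidAlgebra R G) s) : g ∈ K := by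
  have h := mapDomain_quotientMk_eq_zero_of_mem_span hs hg
  rw [MonoidAlgebra.one_def, monoidAlgebra_mapDomain_sub, mapDomain_single, mapDomain_single,
    sub_eq_zero, single_left_inj one_ne_zero] at h
  simpa using QuotientGroup.eq.mp h.symm

theorem group_fg_of_isNoetherianRing_monoidAlgebra (R G : Type*) [Ring R] [Nontrivial R]
    [Group G] [IsNoetherianRing (MonoidAlgebra R G)] : Group.FG G := by
  obtain ⟨s, hs, hspan⟩ := (Submodule.fg_span_iff_fg_span_finset_subset
    (R := MonoidAlgebra R G) (Set.range fun g : G => (single g 1 - 1 : MonoidAlgebra R G))).mp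
      (IsNoetherian.noetherian _)
  have hinj : Function.Injective fun g : G => (single g 1 - 1 : MonoidAlgebra R G) :=
    sub_left_injective.comp fun _ _ => (single_left_inj one_ne_zero).mp
  refine Group.fg_iff.mpr ⟨{g | single g 1 - 1 ∈ s}, eq_top_iff.mpr fun g _ => ?_,
    s.finite_toSet.preimage hinj.injOn⟩
  refine mem_of_single_sub_one_mem_span (s := (s : Set (MonoidAlgebra R G))) (fun x hx => ?_)
    (hspan ▸ Submodule.subset_span ⟨g, rfl⟩)
  obtain ⟨h, rfl⟩ := hs hx
  exact ⟨h, Subgroup.subset_closure hx, rfl⟩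

theorem IsLeftOrRightNoetherian.group_fg [Nontrivial R]
    (h : IsLeftOrRightNoetherian (MonoidAlgebra R G)) : Group.FG G := by
  rcases h with _ | _
  · exact group_fg_of_isNoetherianRing_monoidAlgebra R G
  · have : IsNoetherianRing (MonoidAlgebra Rᵐᵒᵖ Gᵐᵒᵖ) :=
      isNoetherianRing_of_ringEquiv _ MonoidAlgebra.opRingEquiv
    have := group_fg_of_isNoetherianRing_monoidAlgebra Rᵐᵒᵖ Gᵐᵒᵖ
    exact Group.fg_of_surjective (f := (MulEquiv.inv' G).symm.toMonoidHom)
      (MulEquiv.inv' G).symm.surjective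

end GroupRing

section GradedAlgebra

variable {k : Type*} {𝒜 : ℕ → Type*} [CommRing k] [∀ n, AddCommGroup (𝒜 n)] [∀ n, Module k (𝒜 n)]

theorem of_apply_mem_of_forall_of_mul_of_mem [DirectSum.GRing 𝒜] {W : Type*}
    [SetLike W (⨁ n, 𝒜 n)] [AddSubmonoidClass W (⨁ n, 𝒜 n)] {B : W}
    {n : ℕ} (x y : ⨁ n, 𝒜 n)
    (h : ∀ i j, i + j = n → DirectSum.of 𝒜 i (x i) * DirectSum.of 𝒜 j (y j) ∈ B) :
    DirectSum.of 𝒜 n ((x * y) n) ∈ B := by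
  classical
  rw [DirectSum.mul_eq_sum_support_ghas_mul, DFinsupp.finsetSum_apply, map_sum]
  refine sum_mem fun p _ => ?_
  by_cases hp : p.1 + p.2 = n
  · subst hp
    rw [DirectSum.of_eq_same, ← DirectSum.of_mul_of]
    exact h p.1 p.2 rfl
  · rw [DirectSum.of_eq_of_ne _ _ _ (Ne.symm hp), map_zero]
    exact zero_mem B

theorem of_mul_apply_zero [DirectSum.GRing 𝒜] (x y : ⨁ n, 𝒜 n) :
    DirectSum.of 𝒜 0 ((x * y) 0) = DirectSum.of 𝒜 0 (x 0) * DirectSum.of 𝒜 0 (y 0) := by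
  induction x using DirectSum.induction_on with
  | zero => simp only [zero_mul, DirectSum.zero_apply, map_zero]
  | add x x' hx hx' => simp only [add_mul, DirectSum.add_apply, map_add, hx, hx']
  | of i a =>
    induction y using DirectSum.induction_on with
    | zero => simp only [mul_zero, DirectSum.zero_apply, map_zero]
    | add y y' hy hy' => simp only [mul_add, DirectSum.add_apply, map_add, hy, hy']
    | of j b =>
      rcases i with _ | i
      · rcases j with _ | j
        · simp only [DirectSum.of_mul_of, DirectSum.of_eq_same]
        · rw [DirectSum.of_mul_of, DirectSum.of_eq_of_ne _ _ _ (by omega),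
            DirectSum.of_eq_of_ne _ _ b (by omega), map_zero, mul_zero]
      · rw [DirectSum.of_mul_of, DirectSum.of_eq_of_ne _ _ _ (by omega),
          DirectSum.of_eq_of_ne _ _ a (by omega), map_zero, zero_mul]

theorem finite_range_of_apply (x : ⨁ n, 𝒜 n) :
    (Set.range fun n => DirectSum.of 𝒜 n (x n)).Finite := by
  classical
  refine ((x.support.finite_toSet.image fun n => DirectSum.of 𝒜 n (x n)).insert 0).subset ?_
  rintro _ ⟨n, rfl⟩
  by_cases hn : x n = 0
  · exact Or.inl (by simp only [hn, map_zero])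
  · exact Or.inr ⟨n, DFinsupp.mem_support_iff.mpr hn, rfl⟩

variable [DirectSum.GRing 𝒜] [DirectSum.GAlgebra k 𝒜]

variable (k 𝒜) in
/-- The degree zero part of a graded algebra, as a subalgebra. -/
def degreeZeroSubalgebra : Subalgebra k (⨁ n, 𝒜 n) where
  carrier := Set.range (DirectSum.of 𝒜 0)
  mul_mem' := by
    rintro _ _ ⟨a, rfl⟩ ⟨b, rfl⟩
    exact ⟨_, (DirectSum.of_mul_of a b).symm⟩
  add_mem' := by
    rintro _ _ ⟨a, rfl⟩ ⟨b, rfl⟩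
    exact ⟨a + b, map_add _ a b⟩
  algebraMap_mem' r := ⟨_, rfl⟩

variable (k 𝒜) in
/-- The projection of a graded algebra onto its degree zero part; its kernel is the irrelevant
ideal. -/
def degreeZeroProjection : (⨁ n, 𝒜 n) →ₐ[k] degreeZeroSubalgebra k 𝒜 :=
  AlgHom.ofLinearMap
    ((DirectSum.lof k ℕ 𝒜 0 ∘ₗ DirectSum.component k ℕ 𝒜 0).codRestrict
      (degreeZeroSubalgebra k 𝒜).toSubmodule fun a => ⟨a 0, rfl⟩)
    (Subtype.ext (congrArg (DirectSum.of 𝒜 0) (DirectSum.of_eq_same 0 GradedMonoid.GOne.one)))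
    (fun x y => Subtype.ext (of_mul_apply_zero x y))

theorem coe_degreeZeroProjection (a : ⨁ n, 𝒜 n) :
    (degreeZeroProjection k 𝒜 a : ⨁ n, 𝒜 n) = DirectSum.of 𝒜 0 (a 0) := rfl

theorem degreeZeroProjection_eq_zero_iff {a : ⨁ n, 𝒜 n} :
    degreeZeroProjection k 𝒜 a = 0 ↔ a 0 = 0 := by
  rw [← ZeroMemClass.coe_eq_zero, coe_degreeZeroProjection,
    map_eq_zero_iff _ (DirectSum.of_injective 0)]

theorem degreeZeroProjection_surjective : Function.Surjective (degreeZeroProjection k 𝒜) := by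
  rintro ⟨_, a, rfl⟩
  refine ⟨DirectSum.of 𝒜 0 a, Subtype.ext ?_⟩
  rw [coe_degreeZeroProjection, DirectSum.of_eq_same]

theorem subalgebra_eq_top_of_forall_of_mem {B : Subalgebra k (⨁ n, 𝒜 n)}
    (h : ∀ n a, DirectSum.of 𝒜 n a ∈ B) : B = ⊤ := by
  refine eq_top_iff.mpr fun x _ => ?_
  induction x using DirectSum.induction_on with
  | zero => exact zero_mem B
  | add x y hx hy => exact add_mem (hx trivial) (hy trivial)
  | of n a => exact h n a

open scoped Pointwise in
theorem of_apply_mem_of_mem_closure {s : Set (⨁ n, 𝒜 n)} (hs0 : ∀ x ∈ s, x 0 = 0)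
    {B : Subalgebra k (⨁ n, 𝒜 n)} (hsB : ∀ x ∈ s, ∀ n, DirectSum.of 𝒜 n (x n) ∈ B) {n : ℕ}
    (hB : ∀ i < n, ∀ a, DirectSum.of 𝒜 i a ∈ B) {z : ⨁ n, 𝒜 n}
    (hz : z ∈ AddSubmonoid.closure (Set.univ * s ∪ s * Set.univ)) :
    DirectSum.of 𝒜 n (z n) ∈ B := by
  -- the factor from `s` has no component of degree zero, so the other one has degree below `n`
  have hs : ∀ x ∈ s, ∀ j, 0 < j ∨ DirectSum.of 𝒜 j (x j) = 0 := fun x hx j =>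
    j.eq_zero_or_pos.symm.imp_right (by rintro rfl; rw [hs0 x hx, map_zero])
  induction hz using AddSubmonoid.closure_induction with
  | zero => rw [DirectSum.zero_apply, map_zero]; exact zero_mem B
  | add x y _ _ hx hy => rw [DirectSum.add_apply, map_add]; exact add_mem hx hy
  | mem z hz =>
    rcases hz with ⟨r, -, x, hx, rfl⟩ | ⟨x, hx, r, -, rfl⟩
    · refine of_apply_mem_of_forall_of_mul_of_mem r x fun i j hij => ?_
      rcases hs x hx j with hj | hj
      · exact mul_mem (hB i (by omega) (r i)) (hsB x hx j)
      · rw [hj, mul_zero]; exact zero_mem B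
    · refine of_apply_mem_of_forall_of_mul_of_mem x r fun i j hij => ?_
      rcases hs x hx i with hi | hi
      · exact mul_mem (hsB x hx i) (hB j (by omega) (r j))
      · rw [hi, zero_mul]; exact zero_mem B

open scoped Pointwise in
theorem subalgebra_eq_top_of_irrelevant_subset_closure {s : Set (⨁ n, 𝒜 n)}
    (hs0 : ∀ x ∈ s, x 0 = 0)
    (hs : ∀ a : ⨁ n, 𝒜 n, a 0 = 0 → a ∈ AddSubmonoid.closure (Set.univ * s ∪ s * Set.univ))
    {B : Subalgebra k (⨁ n, 𝒜 n)} (hB : degreeZeroSubalgebra k 𝒜 ≤ B)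
    (hsB : ∀ x ∈ s, ∀ n, DirectSum.of 𝒜 n (x n) ∈ B) : B = ⊤ := by
  refine subalgebra_eq_top_of_forall_of_mem fun n => ?_
  induction n using Nat.strong_induction_on with
  | _ n ih =>
  intro a
  rcases n.eq_zero_or_pos with rfl | hn
  · exact hB ⟨a, rfl⟩
  · have ha : DirectSum.of 𝒜 n (DirectSum.of 𝒜 n a n) ∈ B :=
      of_apply_mem_of_mem_closure hs0 hsB ih (hs _ (DirectSum.of_eq_of_ne _ _ _ hn.ne))
    rwa [DirectSum.of_eq_same] at ha

theorem finiteType_directSum_of_isLeftOrRightNoetherian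
    (hN : IsLeftOrRightNoetherian (⨁ n, 𝒜 n))
    (h0 : Algebra.FiniteType k (degreeZeroSubalgebra k 𝒜)) :
    Algebra.FiniteType k (⨁ n, 𝒜 n) := by
  obtain ⟨s, hsfin, hs0, hs⟩ :=
    hN.exists_finite_ker_subset_closure (degreeZeroProjection k 𝒜).toRingHom
  let T : Set (⨁ n, 𝒜 n) := ⋃ x ∈ s, Set.range fun n => DirectSum.of 𝒜 n (x n)
  have hT : T.Finite := hsfin.biUnion fun x _ => finite_range_of_apply x
  have htop : degreeZeroSubalgebra k 𝒜 ⊔ Algebra.adjoin k T = ⊤ :=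
    subalgebra_eq_top_of_irrelevant_subset_closure
      (fun x hx => degreeZeroProjection_eq_zero_iff.mp (hs0 x hx))
      (fun a ha => hs a (degreeZeroProjection_eq_zero_iff.mpr ha)) le_sup_left
      (fun x hx n => le_sup_right (a := degreeZeroSubalgebra k 𝒜)
        (Algebra.subset_adjoin (Set.mem_biUnion hx ⟨n, rfl⟩)))
  exact ⟨htop ▸ ((degreeZeroSubalgebra k 𝒜).fg_iff_finiteType.mpr h0).sup
    (Subalgebra.fg_def.mpr ⟨T, hT, rfl⟩)⟩

end GradedAlgebra

section FilteredAlgebra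

variable {k A : Type*} [Field k] [Ring A] [Algebra k A] (F : ℕ → Submodule k A)

/-- The class in degree `n` of the associated graded algebra of an element of `Fₙ`; it vanishes on
`Fₙ₋₁`. -/
def initialForm (n : ℕ) : F n →ₗ[k] ⨁ n, GradedPiece F n :=
  DirectSum.lof k ℕ (GradedPiece F) n ∘ₗ ((shiftFiltration F n).submoduleOf (F n)).mkQ

variable {F}

theorem initialForm_eq_iff {n : ℕ} {a b : F n} :
    initialForm F n a = initialForm F n b ↔ (a - b : A) ∈ shiftFiltration F n :=
  (DirectSum.of_injective n).eq_iff.trans GradedPiece.mk_eq_mk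

theorem exists_initialForm_eq (n : ℕ) (z : GradedPiece F n) :
    ∃ a, initialForm F n a = DirectSum.of (GradedPiece F) n z := by
  obtain ⟨a, rfl⟩ := Submodule.Quotient.mk_surjective _ z
  exact ⟨a, rfl⟩

theorem initialForm_of_apply (n : ℕ) (a : F n) :
    DirectSum.of (GradedPiece F) n (initialForm F n a n) = initialForm F n a :=
  congrArg (DirectSum.of (GradedPiece F) n) (DirectSum.of_eq_same n _)

variable [SetLike.GradedMonoid F]

theorem initialForm_mul {i j n : ℕ} (h : i + j = n) (a : F i) (b : F j) (c : F n)
    (hc : (c : A) = a * b) :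
    initialForm F i a * initialForm F j b = initialForm F n c := by
  subst h
  refine (DirectSum.of_mul_of _ _).trans (congrArg (DirectSum.of (GradedPiece F) (i + j)) ?_)
  exact congrArg (GradedPiece.mk (i + j)) (Subtype.ext hc.symm)

variable (F) in
/-- The associated graded algebra of a subalgebra `B` for the induced filtration `B ∩ Fₙ`, as a
subalgebra of the associated graded algebra of the whole algebra. -/
def associatedGradedSubalgebra (B : Subalgebra k A) : Subalgebra k (⨁ n, GradedPiece F n) where
  carrier := {z | ∀ n, DirectSum.of (GradedPiece F) n (z n) ∈
    (B.toSubmodule.submoduleOf (F n)).map (initialForm F n)}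
  mul_mem' {x y} hx hy n := of_apply_mem_of_forall_of_mul_of_mem x y fun i j hij => by
    obtain ⟨a, ha, hax⟩ := hx i
    obtain ⟨b, hb, hby⟩ := hy j
    subst hij
    rw [← hax, ← hby, initialForm_mul rfl a b ⟨a * b, SetLike.mul_mem_graded a.2 b.2⟩ rfl]
    exact ⟨_, mul_mem (S := Subalgebra k A) ha hb, rfl⟩
  add_mem' {x y} hx hy n := by
    rw [DirectSum.add_apply, map_add]
    exact add_mem (hx n) (hy n)
  algebraMap_mem' r n := by
    rcases n with _ | n
    · rw [DirectSum.algebraMap_apply, DirectSum.of_eq_same]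
      exact ⟨r • ⟨1, SetLike.one_mem_graded F⟩, B.smul_mem B.one_mem r, rfl⟩
    · rw [DirectSum.algebraMap_apply, DirectSum.of_eq_of_ne _ _ _ n.succ_ne_zero, map_zero]
      exact zero_mem _

theorem le_of_associatedGradedSubalgebra_eq_top {B : Subalgebra k A}
    (hB : associatedGradedSubalgebra F B = ⊤) (n : ℕ) : F n ≤ B.toSubmodule := by
  induction n using Nat.strong_induction_on with
  | _ n ih =>
  intro x hx
  have htop : initialForm F n ⟨x, hx⟩ ∈ associatedGradedSubalgebra F B := hB ▸ Algebra.mem_top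
  obtain ⟨b, hb, hbx⟩ := htop n
  rw [initialForm_of_apply, initialForm_eq_iff] at hbx
  have hsub : shiftFiltration F n ≤ B.toSubmodule := by
    rcases n with _ | n
    · exact bot_le
    · exact ih n n.lt_succ_self
  simpa using B.toSubmodule.sub_mem hb (hsub hbx)

theorem finiteType_of_finiteType_associatedGraded (hF : ∀ x : A, ∃ n, x ∈ F n)
    (hgr : Algebra.FiniteType k (⨁ n, GradedPiece F n)) : Algebra.FiniteType k A := by
  obtain ⟨s, hs⟩ := hgr.out
  choose lift hlift using exists_initialForm_eq (F := F)
  let T : Set A := ⋃ x ∈ s, (fun n => (lift n (x n) : A)) '' {n | x n ≠ 0}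
  have hT : T.Finite := s.finite_toSet.biUnion fun x _ => (DFinsupp.finite_support x).image _
  have hsub : (s : Set (⨁ n, GradedPiece F n)) ⊆
      associatedGradedSubalgebra F (Algebra.adjoin k T) := fun x hx n => by
    by_cases h0 : x n = 0
    · rw [h0, map_zero]
      exact zero_mem _
    · exact ⟨lift n (x n), Algebra.subset_adjoin (Set.mem_biUnion hx ⟨n, h0, rfl⟩), hlift n (x n)⟩
  have htop : associatedGradedSubalgebra F (Algebra.adjoin k T) = ⊤ :=
    top_le_iff.mp (hs ▸ Algebra.adjoin_le hsub)
  refine ⟨Subalgebra.fg_def.mpr ⟨T, hT, eq_top_iff.mpr fun x _ => ?_⟩⟩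
  obtain ⟨n, hn⟩ := hF x
  exact le_of_associatedGradedSubalgebra_eq_top htop n hn

/-- The identification of a subalgebra with underlying space `F₀` with the degree zero part of the
associated graded algebra. -/
noncomputable def degreeZeroEquiv {B : Subalgebra k A} (hB : B.toSubmodule = F 0) :
    B ≃ₐ[k] degreeZeroSubalgebra k (GradedPiece F) :=
  let φ : B →ₗ[k] ⨁ n, GradedPiece F n := initialForm F 0 ∘ₗ (LinearEquiv.ofEq _ _ hB).toLinearMap
  have φ_mul (x y : B) : φ (x * y) = φ x * φ y :=
    (initialForm_mul (F := F) (zero_add 0) ⟨x, hB.le x.2⟩ ⟨y, hB.le y.2⟩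
      ⟨(x * y : B), hB.le (x * y).2⟩ rfl).symm
  AlgEquiv.ofBijective
    ((AlgHom.ofLinearMap φ rfl φ_mul).codRestrict _ fun b => ⟨_, rfl⟩)
    ⟨fun x y hxy => by
      have h := initialForm_eq_iff.mp (congrArg Subtype.val hxy)
      exact Subtype.ext (sub_eq_zero.mp ((Submodule.mem_bot k).mp h)), by
      rintro ⟨_, z, rfl⟩
      obtain ⟨a, ha⟩ := exists_initialForm_eq 0 z
      exact ⟨⟨a, hB.ge a.2⟩, Subtype.ext ha⟩⟩

end FilteredAlgebra

section TensorDual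

variable {k M N : Type*} [CommRing k] [AddCommGroup M] [Module k M] [AddCommGroup N] [Module k N]

theorem tensor_eq_zero_of_forall_dual [Module.Free k M] [Module.Free k N] {t : M ⊗[k] N}
    (h : ∀ (φ : Module.Dual k M) (ψ : Module.Dual k N),
      LinearMap.mul' k k (TensorProduct.map φ ψ t) = 0) : t = 0 := by
  let b := Module.Free.chooseBasis k M
  let c := Module.Free.chooseBasis k N
  refine (b.tensorProduct c).ext_elem fun ⟨i, j⟩ => ?_
  have hcoord : (b.tensorProduct c).coord (i, j) =
      LinearMap.mul' k k ∘ₗ TensorProduct.map (b.coord i) (c.coord j) := by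
    ext; simp [mul_comm]
  exact (LinearMap.congr_fun hcoord t).trans ((h _ _).trans (by simp))

theorem eq_of_forall_withConv_apply_eq [Module.Projective k M] {x y : M}
    (h : ∀ f : WithConv (Module.Dual k M), f x = f y) : x = y :=
  sub_eq_zero.mp <| (Module.forall_dual_apply_eq_zero_iff k _).mp fun f =>
    (map_sub f x y).trans (sub_eq_zero.mpr (h (WithConv.toConv f)))

variable (k M N) in
/-- Evaluation of a linear form on the first factor of a tensor: `(f, ∑ aᵢ ⊗ bᵢ) ↦ ∑ f(aᵢ) bᵢ`. -/
noncomputable def contractFst : Module.Dual k M →ₗ[k] M ⊗[k] N →ₗ[k] N :=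
  (TensorProduct.lid k N).toLinearMap.compRight k ∘ₗ LinearMap.rTensorHom N

theorem apply_contractFst (f : Module.Dual k M) (g : Module.Dual k N) (t : M ⊗[k] N) :
    g (contractFst k M N f t) = LinearMap.mul' k k (TensorProduct.map f g t) := by
  have : g ∘ₗ contractFst k M N f = LinearMap.mul' k k ∘ₗ TensorProduct.map f g := by
    ext; simp [contractFst]
  exact LinearMap.congr_fun this t

theorem apply_contractFst_comm (f : Module.Dual k N) (g : Module.Dual k M) (t : M ⊗[k] N) :
    g (contractFst k N M f (TensorProduct.comm k M N t)) =
      LinearMap.mul' k k (TensorProduct.map g f t) := by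
  have : g ∘ₗ contractFst k N M f ∘ₗ (TensorProduct.comm k M N).toLinearMap =
      LinearMap.mul' k k ∘ₗ TensorProduct.map g f := by
    ext; simp [contractFst, mul_comm]
  exact LinearMap.congr_fun this t

theorem fg_range_contractFst_flip [IsNoetherianRing k] (t : M ⊗[k] N) :
    (LinearMap.range ((contractFst k M N).flip t)).FG := by
  induction t with
  | zero => simpa using Submodule.fg_bot
  | tmul a b =>
    refine (Submodule.fg_span_singleton b).of_le ?_
    rintro _ ⟨f, rfl⟩
    exact Submodule.mem_span_singleton.mpr ⟨f a, by simp [contractFst]⟩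
  | add t u ht hu =>
    refine (ht.sup hu).of_le ?_
    rw [map_add]
    rintro _ ⟨f, rfl⟩
    exact Submodule.add_mem_sup ⟨f, rfl⟩ ⟨f, rfl⟩

end TensorDual

section DualAlgebra

variable {k C : Type*} [Field k] [AddCommGroup C] [Module k C] [Coalgebra k C]

variable (k C) in
/-- The dual algebra of a coalgebra: its linear forms with the convolution product
`(f * g)(c) = f(c₁) g(c₂)`. -/
abbrev DualAlgebra : Type _ := WithConv (Module.Dual k C)

variable (k C) in
/-- The right hit action `c ↼ f = f(c₁) c₂` of the dual algebra on a coalgebra. -/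
noncomputable def rightHit : DualAlgebra k C →ₗ[k] C →ₗ[k] C :=
  (comul (R := k) (A := C)).lcomp k C ∘ₗ contractFst k C C ∘ₗ
    (WithConv.linearEquiv k (Module.Dual k C)).toLinearMap

variable (k C) in
/-- The left hit action `f ⇀ c = c₁ f(c₂)` of the dual algebra on a coalgebra. -/
noncomputable def leftHit : DualAlgebra k C →ₗ[k] C →ₗ[k] C :=
  ((TensorProduct.comm k C C).toLinearMap ∘ₗ comul (R := k) (A := C)).lcomp k C ∘ₗ
    contractFst k C C ∘ₗ (WithConv.linearEquiv k (Module.Dual k C)).toLinearMap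

theorem apply_rightHit (f g : DualAlgebra k C) (c : C) : g (rightHit k C f c) = (f * g) c :=
  apply_contractFst f.ofConv g.ofConv (comul c)

theorem apply_leftHit (f g : DualAlgebra k C) (c : C) : g (leftHit k C f c) = (g * f) c :=
  apply_contractFst_comm f.ofConv g.ofConv (comul c)

theorem rightHit_one (c : C) : rightHit k C 1 c = c :=
  eq_of_forall_withConv_apply_eq (k := k) fun f => by rw [apply_rightHit, one_mul]

theorem leftHit_one (c : C) : leftHit k C 1 c = c :=
  eq_of_forall_withConv_apply_eq (k := k) fun f => by rw [apply_leftHit, mul_one]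

theorem rightHit_mul (f g : DualAlgebra k C) (c : C) :
    rightHit k C (f * g) c = rightHit k C g (rightHit k C f c) :=
  eq_of_forall_withConv_apply_eq (k := k) fun h => by simp only [apply_rightHit, mul_assoc]

theorem leftHit_mul (f g : DualAlgebra k C) (c : C) :
    leftHit k C (f * g) c = leftHit k C f (leftHit k C g c) :=
  eq_of_forall_withConv_apply_eq (k := k) fun h => by simp only [apply_leftHit, mul_assoc]

theorem leftHit_rightHit_comm (f g : DualAlgebra k C) (c : C) :
    leftHit k C f (rightHit k C g c) = rightHit k C g (leftHit k C f c) :=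
  eq_of_forall_withConv_apply_eq (k := k) fun h => by
    simp only [apply_leftHit, apply_rightHit, mul_assoc]

theorem fg_range_rightHit_flip (c : C) : (LinearMap.range ((rightHit k C).flip c)).FG :=
  (fg_range_contractFst_flip (comul c)).of_le <| by
    rintro _ ⟨f, rfl⟩
    exact ⟨f.ofConv, rfl⟩

theorem fg_range_leftHit_flip (c : C) : (LinearMap.range ((leftHit k C).flip c)).FG :=
  (fg_range_contractFst_flip (TensorProduct.comm k C C (comul c))).of_le <| by
    rintro _ ⟨f, rfl⟩
    exact ⟨f.ofConv, rfl⟩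

theorem mem_coalgebraWedge_iff {X Y : Submodule k C} {c : C} :
    c ∈ coalgebraWedge k X Y ↔ ∀ f g : DualAlgebra k C,
      (∀ x ∈ X, f x = 0) → (∀ y ∈ Y, g y = 0) → (f * g) c = 0 := by
  have hconv (φ : Module.Dual k (C ⧸ X)) (ψ : Module.Dual k (C ⧸ Y)) :
      LinearMap.mul' k k (TensorProduct.map φ ψ (TensorProduct.map X.mkQ Y.mkQ (comul c))) =
        (WithConv.toConv (φ ∘ₗ X.mkQ) * WithConv.toConv (ψ ∘ₗ Y.mkQ)) c := by
    rw [← LinearMap.comp_apply (TensorProduct.map φ ψ), ← TensorProduct.map_comp]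
    rfl
  rw [coalgebraWedge_eq_ker, LinearMap.mem_ker, LinearMap.comp_apply]
  constructor
  · intro hc f g hf hg
    have h := hconv (X.liftQ f.ofConv hf) (Y.liftQ g.ofConv hg)
    rw [hc, map_zero, map_zero] at h
    exact h.symm
  · refine fun h => tensor_eq_zero_of_forall_dual fun φ ψ => (hconv φ ψ).trans (h _ _ ?_ ?_)
    · intro x hx
      exact (congrArg φ ((Submodule.Quotient.mk_eq_zero X).mpr hx)).trans (map_zero φ)
    · intro y hy
      exact (congrArg ψ ((Submodule.Quotient.mk_eq_zero Y).mpr hy)).trans (map_zero ψ)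

theorem isSubcoalgebra_iff_le_coalgebraWedge {D : Submodule k C} :
    IsSubcoalgebra k D ↔ D ≤ coalgebraWedge k ⊥ D ∧ D ≤ coalgebraWedge k D ⊥ := by
  have hl : (⊥ : Submodule k C).subtype.lTensor C = 0 := by
    rw [Subsingleton.elim (⊥ : Submodule k C).subtype 0, LinearMap.lTensor_zero]
  have hr : (⊥ : Submodule k C).subtype.rTensor C = 0 := by
    rw [Subsingleton.elim (⊥ : Submodule k C).subtype 0, LinearMap.rTensor_zero]
  simp only [coalgebraWedge, hl, hr, LinearMap.range_zero, bot_sup_eq, sup_bot_eq]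
  exact ⟨fun h => ⟨fun c hc => range_map_le_lTensor D D (h c hc),
      fun c hc => range_map_le_rTensor D D (h c hc)⟩,
    fun h c hc => range_rTensor_inf_range_lTensor D D ⟨h.2 hc, h.1 hc⟩⟩

theorem isSubcoalgebra_of_hit_mem {D : Submodule k C}
    (hr : ∀ f, ∀ c ∈ D, rightHit k C f c ∈ D) (hl : ∀ f, ∀ c ∈ D, leftHit k C f c ∈ D) :
    IsSubcoalgebra k D :=
  isSubcoalgebra_iff_le_coalgebraWedge.mpr
    ⟨fun c hc => mem_coalgebraWedge_iff.mpr fun f g _ hg =>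
        (apply_rightHit f g c).symm.trans (hg _ (hr f c hc)),
      fun c hc => mem_coalgebraWedge_iff.mpr fun f g hf _ =>
        (apply_leftHit g f c).symm.trans (hf _ (hl g c hc))⟩

theorem fg_map₂_rightHit_flip_top {V : Submodule k C} (hV : V.FG) :
    (Submodule.map₂ (rightHit k C).flip V ⊤).FG := by
  induction V, hV using Submodule.fg_induction with
  | singleton v =>
    rw [Submodule.map₂_span_singleton_eq_map, Submodule.map_top]
    exact fg_range_rightHit_flip v
  | sup V W _ _ hV hW =>
    rw [Submodule.map₂_sup_left]
    exact hV.sup hW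

/-- The fundamental theorem of coalgebras: `x` lies in the finite-dimensional subcoalgebra
`(C* ⇀ x) ↼ C*`. -/
theorem exists_finite_isSubcoalgebra_mem (x : C) :
    ∃ E : Submodule k C, Module.Finite k E ∧ IsSubcoalgebra k E ∧ x ∈ E := by
  let V : Submodule k C := LinearMap.range ((leftHit k C).flip x)
  let E : Submodule k C := Submodule.map₂ (rightHit k C).flip V ⊤
  have hE (v : C) (hv : v ∈ V) (g : DualAlgebra k C) : rightHit k C g v ∈ E :=
    Submodule.apply_mem_map₂ _ hv Submodule.mem_top
  have hright (f : DualAlgebra k C) : E ≤ E.comap (rightHit k C f) :=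
    Submodule.map₂_le.mpr fun v hv g _ => by
      change rightHit k C f (rightHit k C g v) ∈ E
      rw [← rightHit_mul]
      exact hE v hv _
  have hleft (f : DualAlgebra k C) : E ≤ E.comap (leftHit k C f) :=
    Submodule.map₂_le.mpr <| by
      rintro _ ⟨h, rfl⟩ g _
      change leftHit k C f (rightHit k C g (leftHit k C h x)) ∈ E
      rw [leftHit_rightHit_comm, ← leftHit_mul]
      exact hE _ ⟨f * h, rfl⟩ g
  have hxE : rightHit k C 1 x ∈ E := hE x ⟨1, leftHit_one x⟩ 1
  exact ⟨E, Module.Finite.iff_fg.mpr (fg_map₂_rightHit_flip_top (fg_range_leftHit_flip x)),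
    isSubcoalgebra_of_hit_mem hright hleft, rightHit_one (k := k) x ▸ hxE⟩

end DualAlgebra

section MaximalTwoSidedIdeals

theorem isCoatom_comap_of_surjective {R S : Type*} [Ring R] [Ring S] {f : R →+* S}
    (hf : Function.Surjective f) {I : TwoSidedIdeal S} (hI : IsCoatom I) :
    IsCoatom (I.comap f) := by
  refine ⟨fun h => hI.1 (I.one_mem_iff.mp ?_), fun L hL => L.one_mem_iff.mp ?_⟩
  · simpa only [TwoSidedIdeal.mem_comap, map_one] using (I.comap f).one_mem_iff.mpr h
  · let J : TwoSidedIdeal S := .mk' (f '' L) ⟨0, L.zero_mem, map_zero f⟩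
      (by rintro _ _ ⟨x, hx, rfl⟩ ⟨y, hy, rfl⟩; exact ⟨x + y, L.add_mem hx hy, map_add f x y⟩)
      (by rintro _ ⟨x, hx, rfl⟩; exact ⟨-x, L.neg_mem hx, map_neg f x⟩)
      (by
        rintro s _ ⟨x, hx, rfl⟩
        obtain ⟨a, rfl⟩ := hf s
        exact ⟨a * x, L.mul_mem_left a x hx, map_mul f a x⟩)
      (by
        rintro _ s ⟨x, hx, rfl⟩
        obtain ⟨a, rfl⟩ := hf s
        exact ⟨x * a, L.mul_mem_right x a hx, map_mul f x a⟩)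
    have mem_J (s : S) : s ∈ J ↔ s ∈ f '' L := TwoSidedIdeal.mem_mk' _ _ _ _ _ _ _
    obtain ⟨x, hxL, hxI⟩ := Set.not_subset.mp (not_le_of_gt hL)
    have hIJ : I < J := by
      refine SetLike.lt_iff_le_and_exists.mpr ⟨fun s hs => ?_, f x, (mem_J _).mpr ⟨x, hxL, rfl⟩,
        fun h => hxI ((TwoSidedIdeal.mem_comap f).mpr h)⟩
      obtain ⟨a, rfl⟩ := hf s
      exact (mem_J _).mpr ⟨a, hL.le ((TwoSidedIdeal.mem_comap f).mpr hs), rfl⟩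
    obtain ⟨y, hyL, hy⟩ := (mem_J 1).mp (J.one_mem_iff.mpr (hI.2 J hIJ))
    have hker : 1 - y ∈ I.comap f := by
      rw [TwoSidedIdeal.mem_comap, map_sub, map_one, hy, sub_self]
      exact I.zero_mem
    simpa using L.add_mem (hL.le hker) hyL

theorem ideal_pow_le_comap_pow {R S : Type*} [Ring R] [Ring S] {f : R →+* S} {I : Ideal R}
    {J : Ideal S} (h : I ≤ J.comap f) (n : ℕ) : I ^ n ≤ (J ^ n).comap f := by
  induction n with
  | zero => simp only [Submodule.pow_zero, Ideal.one_eq_top, Ideal.comap_top, le_refl]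
  | succ n ih =>
    rw [Submodule.pow_succ, Submodule.pow_succ, Ideal.mul_le]
    intro x hx y hy
    rw [Ideal.mem_comap, map_mul]
    exact Ideal.mul_mem_mul (ih hx) (h hy)

theorem mem_jacobson_of_forall_mem_of_isCoatom {R : Type*} [Ring R] [IsArtinianRing R] {x : R}
    (h : ∀ I : TwoSidedIdeal R, IsCoatom I → x ∈ I) : x ∈ Ring.jacobson R := by
  obtain ⟨n, D, d, _, hd, ⟨e⟩⟩ :=
    IsSemisimpleRing.exists_ringEquiv_pi_matrix_divisionRing (R ⧸ Ring.jacobson R)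
  rw [← Ideal.Quotient.eq_zero_iff_mem]
  refine e.injective (funext fun i => ?_)
  have := hd i
  let π : R →+* Matrix (Fin (d i)) (Fin (d i)) (D i) :=
    (Pi.evalRingHom (fun i => Matrix (Fin (d i)) (Fin (d i)) (D i)) i).comp
      (e.toRingHom.comp (Ideal.Quotient.mk (Ring.jacobson R)))
  have hπ : Function.Surjective π :=
    (Function.surjective_eval i).comp (e.surjective.comp Ideal.Quotient.mk_surjective)
  have hx : π x = 0 := (TwoSidedIdeal.mem_bot _).mp <|
    (TwoSidedIdeal.mem_comap π).mp (h _ (isCoatom_comap_of_surjective hπ isCoatom_bot))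
  exact hx.trans (congrFun (map_zero e) i).symm

theorem exists_pow_le_of_forall_le_of_isCoatom {R : Type*} [Ring R] {J K : TwoSidedIdeal R}
    [IsArtinianRing (R ⧸ K.asIdeal)] (hJ : ∀ I : TwoSidedIdeal R, IsCoatom I → K ≤ I → J ≤ I) :
    ∃ n, J.asIdeal ^ n ≤ K.asIdeal := by
  have hrad : J.asIdeal ≤
      (Ring.jacobson (R ⧸ K.asIdeal)).comap (Ideal.Quotient.mk K.asIdeal) := fun x hx =>
    mem_jacobson_of_forall_mem_of_isCoatom fun I hI => by
      refine (TwoSidedIdeal.mem_comap _).mp <|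
        hJ _ (isCoatom_comap_of_surjective Ideal.Quotient.mk_surjective hI) (fun y hy => ?_) hx
      rw [TwoSidedIdeal.mem_comap, Ideal.Quotient.eq_zero_iff_mem.mpr hy]
      exact I.zero_mem
  obtain ⟨n, hn⟩ := IsSemiprimaryRing.isNilpotent (R := R ⧸ K.asIdeal)
  have hpow := ideal_pow_le_comap_pow hrad n
  rw [hn, Ideal.zero_eq_bot, ← RingHom.ker_eq_comap_bot, Ideal.mk_ker] at hpow
  exact ⟨n, hpow⟩

end MaximalTwoSidedIdeals

section Exhaustion

variable {k C : Type*} [Field k] [AddCommGroup C] [Module k C] [Coalgebra k C]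

/-- The two-sided ideal of the dual algebra of the linear forms vanishing on a subcoalgebra. -/
noncomputable def annihilatorIdeal {D : Submodule k C} (hD : IsSubcoalgebra k D) :
    TwoSidedIdeal (DualAlgebra k C) :=
  .mk' {f | ∀ c ∈ D, f c = 0} (fun _ _ => rfl)
    (fun {f g} hf hg c hc => (congrArg₂ (· + ·) (hf c hc) (hg c hc)).trans (add_zero 0))
    (fun {f} hf c hc => (congrArg (- ·) (hf c hc)).trans neg_zero)
    (fun {f g} hg c hc => mem_coalgebraWedge_iff.mp
      ((isSubcoalgebra_iff_le_coalgebraWedge.mp hD).1 hc) f g (by simp) hg)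
    (fun {f g} hf c hc => mem_coalgebraWedge_iff.mp
      ((isSubcoalgebra_iff_le_coalgebraWedge.mp hD).2 hc) f g hf (by simp))

theorem mem_annihilatorIdeal {D : Submodule k C} {hD : IsSubcoalgebra k D} {f : DualAlgebra k C} :
    f ∈ annihilatorIdeal hD ↔ ∀ c ∈ D, f c = 0 :=
  TwoSidedIdeal.mem_mk' _ _ _ _ _ _ _

theorem annihilatorIdeal_eq_top_iff {D : Submodule k C} {hD : IsSubcoalgebra k D} :
    annihilatorIdeal hD = ⊤ ↔ D = ⊥ := by
  constructor
  · intro h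
    refine eq_bot_iff.mpr fun c hc => eq_of_forall_withConv_apply_eq (k := k) fun f => ?_
    have hf : f ∈ annihilatorIdeal hD := h ▸ TwoSidedIdeal.mem_top _
    exact (mem_annihilatorIdeal.mp hf c hc).trans (map_zero f.ofConv).symm
  · rintro rfl
    exact eq_top_iff.mpr fun f _ => mem_annihilatorIdeal.mpr (by simp)

/-- The subspace of a coalgebra on which all the linear forms of a two-sided ideal of the dual
algebra vanish. -/
def coannihilator (I : TwoSidedIdeal (DualAlgebra k C)) : Submodule k C :=
  ⨅ f ∈ I, LinearMap.ker f.ofConv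

theorem mem_coannihilator {I : TwoSidedIdeal (DualAlgebra k C)} {c : C} :
    c ∈ coannihilator I ↔ ∀ f ∈ I, f c = 0 := by
  simp only [coannihilator, Submodule.mem_iInf, LinearMap.mem_ker]

theorem isSubcoalgebra_coannihilator (I : TwoSidedIdeal (DualAlgebra k C)) :
    IsSubcoalgebra k (coannihilator I) := by
  refine isSubcoalgebra_of_hit_mem (fun f c hc => mem_coannihilator.mpr fun g hg => ?_)
    (fun f c hc => mem_coannihilator.mpr fun g hg => ?_)
  · rw [apply_rightHit]
    exact mem_coannihilator.mp hc _ (I.mul_mem_left f g hg)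
  · rw [apply_leftHit]
    exact mem_coannihilator.mp hc _ (I.mul_mem_right g f hg)

theorem le_of_annihilatorIdeal_le {D D' : Submodule k C} {hD : IsSubcoalgebra k D}
    {hD' : IsSubcoalgebra k D'} (h : annihilatorIdeal hD ≤ annihilatorIdeal hD') : D' ≤ D := by
  intro c hc
  by_contra hcD
  obtain ⟨f, hfc, hf⟩ := Submodule.exists_le_ker_of_notMem hcD
  exact hfc (mem_annihilatorIdeal.mp (h (mem_annihilatorIdeal.mpr fun d hd => hf hd) :
    WithConv.toConv f ∈ annihilatorIdeal hD') c hc)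

/-- Two-sided ideals containing `E^⊥` for a finite-dimensional `E` are closed, because the
subspaces of `E*` are. -/
theorem annihilatorIdeal_coannihilator {E : Submodule k C} [Module.Finite k E]
    {hE : IsSubcoalgebra k E} {I : TwoSidedIdeal (DualAlgebra k C)} (hI : annihilatorIdeal hE ≤ I) :
    annihilatorIdeal (isSubcoalgebra_coannihilator I) = I := by
  refine le_antisymm (fun f hf => ?_) fun f hf =>
    mem_annihilatorIdeal.mpr fun c hc => mem_coannihilator.mp hc f hf
  let res : DualAlgebra k C →ₗ[k] Module.Dual k E :=
    E.subtype.lcomp k k ∘ₗ (WithConv.linearEquiv k (Module.Dual k C)).toLinearMap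
  let W : Submodule k (Module.Dual k E) := (Submodule.restrictScalars k I.asIdeal).map res
  have hW : FiniteDimensional k W := FiniteDimensional.finiteDimensional_submodule W
  have hres : res f ∈ W := by
    rw [← Subspace.dualCoannihilator_dualAnnihilator_eq (W := W), Submodule.mem_dualAnnihilator]
    intro e he
    refine mem_annihilatorIdeal.mp hf e (mem_coannihilator.mpr fun g hg => ?_)
    exact (Submodule.mem_dualCoannihilator e).mp he (res g) ⟨g, hg, rfl⟩
  obtain ⟨g, hg, hgf⟩ := hres
  have hsub : f - g ∈ I := hI <| mem_annihilatorIdeal.mpr fun e he =>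
    sub_eq_zero.mpr (LinearMap.congr_fun hgf ⟨e, he⟩).symm
  simpa using I.add_mem hsub hg

theorem isSimpleSubcoalgebra_coannihilator {E : Submodule k C} [Module.Finite k E]
    {hE : IsSubcoalgebra k E} {I : TwoSidedIdeal (DualAlgebra k C)} (hEI : annihilatorIdeal hE ≤ I)
    (hI : IsCoatom I) : IsSimpleSubcoalgebra k (coannihilator I) := by
  have hann := annihilatorIdeal_coannihilator hEI
  refine ⟨isSubcoalgebra_coannihilator I, fun h => hI.1 (hann ▸ annihilatorIdeal_eq_top_iff.mpr h),
    fun B hB hBI => ?_⟩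
  have hle : I ≤ annihilatorIdeal hB := fun f hf =>
    mem_annihilatorIdeal.mpr fun b hb => mem_coannihilator.mp (hBI hb) f hf
  rcases hI.le_iff.mp hle with h | h
  · exact Or.inl (annihilatorIdeal_eq_top_iff.mp h)
  · exact Or.inr (le_antisymm hBI (le_of_annihilatorIdeal_le (h.trans hann.symm).le))

theorem annihilatorIdeal_coradical_le_of_isCoatom {E : Submodule k C} [Module.Finite k E]
    {hE : IsSubcoalgebra k E} {I : TwoSidedIdeal (DualAlgebra k C)} (hEI : annihilatorIdeal hE ≤ I)
    (hI : IsCoatom I) : annihilatorIdeal (isSubcoalgebra_coradical (k := k) (C := C)) ≤ I := by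
  intro f hf
  rw [← annihilatorIdeal_coannihilator hEI]
  exact mem_annihilatorIdeal.mpr fun c hc => mem_annihilatorIdeal.mp hf c
    (le_sSup (isSimpleSubcoalgebra_coannihilator hEI hI) hc)

theorem finite_quotient_annihilatorIdeal {E : Submodule k C} [Module.Finite k E]
    (hE : IsSubcoalgebra k E) :
    Module.Finite k (DualAlgebra k C ⧸ (annihilatorIdeal hE).asIdeal) := by
  obtain ⟨p, hp⟩ := LinearMap.exists_leftInverse_of_injective E.subtype E.ker_subtype
  let extend : Module.Dual k E →ₗ[k] DualAlgebra k C :=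
    (WithConv.linearEquiv k (Module.Dual k C)).symm.toLinearMap ∘ₗ p.lcomp k k
  refine Module.Finite.of_surjective
    ((Ideal.Quotient.mkₐ k (annihilatorIdeal hE).asIdeal).toLinearMap ∘ₗ extend) fun q => ?_
  obtain ⟨f, rfl⟩ := Ideal.Quotient.mk_surjective q
  refine ⟨f.ofConv ∘ₗ E.subtype, Ideal.Quotient.eq.mpr <| mem_annihilatorIdeal.mpr fun e he => ?_⟩
  have hpe : p e = ⟨e, he⟩ := LinearMap.congr_fun hp ⟨e, he⟩
  exact sub_eq_zero.mpr (congrArg (f.ofConv ∘ₗ E.subtype) hpe)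

theorem exists_pow_annihilatorIdeal_coradical_le {E : Submodule k C} [Module.Finite k E]
    (hE : IsSubcoalgebra k E) :
    ∃ n, (annihilatorIdeal (isSubcoalgebra_coradical (k := k) (C := C))).asIdeal ^ n ≤
      (annihilatorIdeal hE).asIdeal := by
  have := finite_quotient_annihilatorIdeal hE
  have : IsArtinianRing (DualAlgebra k C ⧸ (annihilatorIdeal hE).asIdeal) :=
    IsArtinianRing.of_finite k _
  exact exists_pow_le_of_forall_le_of_isCoatom fun I hI hEI =>
    annihilatorIdeal_coradical_le_of_isCoatom hEI hI

theorem mem_coradicalFiltration_of_forall_pow (n : ℕ) {c : C}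
    (hc : ∀ f ∈ (annihilatorIdeal (isSubcoalgebra_coradical (k := k) (C := C))).asIdeal ^ (n + 1),
      f c = 0) : c ∈ coradicalFiltration k C n := by
  induction n generalizing c with
  | zero =>
    by_contra h
    obtain ⟨f, hfc, hf⟩ := Submodule.exists_le_ker_of_notMem h
    refine hfc (hc (WithConv.toConv f) ?_)
    rw [zero_add, Submodule.pow_one]
    exact mem_annihilatorIdeal.mpr fun b hb => hf hb
  | succ n ih =>
    refine mem_coalgebraWedge_iff.mpr fun f g hf hg => ?_
    rw [← apply_rightHit]
    refine hg _ (ih fun h hh => ?_)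
    rw [apply_rightHit]
    refine hc _ ?_
    rw [Submodule.pow_succ' _ n.succ_ne_zero]
    exact Ideal.mul_mem_mul (mem_annihilatorIdeal.mpr hf) hh

theorem exists_mem_coradicalFiltration (x : C) : ∃ n, x ∈ coradicalFiltration k C n := by
  obtain ⟨E, _, hE, hxE⟩ := exists_finite_isSubcoalgebra_mem (k := k) x
  obtain ⟨n, hn⟩ := exists_pow_annihilatorIdeal_coradical_le hE
  exact ⟨n, mem_coradicalFiltration_of_forall_pow n fun f hf =>
    mem_annihilatorIdeal.mp (hn (Ideal.pow_le_pow_right n.le_succ hf)) x hxE⟩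

end Exhaustion

section PointedHopf

theorem lift_groupLike_injective (k H : Type*) [CommRing k] [IsDomain k] [Ring H] [Bialgebra k H]
    [Module.IsTorsionFree k H] :
    Function.Injective (MonoidAlgebra.lift k H (GroupLike k H) (GroupLike.valMonoidHom k H)) := by
  intro x y hxy
  refine MonoidAlgebra.coeff_injective (linearIndep_groupLikeVal (R := k) (A := H) ?_)
  simpa [MonoidAlgebra.lift_apply, Finsupp.linearCombination_apply] using hxy

variable (k H : Type*) [Field k] [Ring H] [HopfAlgebra k H] [IsPointedCoalgebra k H]

theorem range_lift_groupLike :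
    (MonoidAlgebra.lift k H (GroupLike k H) (GroupLike.valMonoidHom k H)).range =
      coradicalSubalgebra k H := by
  refine le_antisymm ?_ fun x hx => ?_
  · rintro _ ⟨x, rfl⟩
    induction x using MonoidAlgebra.induction_linear with
    | zero => simp
    | add x y hx hy => simpa using add_mem hx hy
    | single g r =>
      have hg : (g : H) ∈ coradicalSubalgebra k H := g.2.mem_coradical
      simpa using Subalgebra.smul_mem _ hg r
  · have hx : x ∈ coradical k H := hx
    rw [coradical_eq_span_groupLike] at hx
    refine (Submodule.span_le (p := Subalgebra.toSubmodule (AlgHom.range _))).mpr ?_ hx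
    intro g hg
    exact ⟨MonoidAlgebra.single ⟨g, hg⟩ 1, by simp⟩

/-- The coradical of a pointed Hopf algebra is the group algebra of its group-like elements. -/
noncomputable def groupLikeAlgEquivCoradical :
    MonoidAlgebra k (GroupLike k H) ≃ₐ[k] coradicalSubalgebra k H :=
  (AlgEquiv.ofInjective _ (lift_groupLike_injective k H)).trans
    (Subalgebra.equivOfEq _ _ (range_lift_groupLike k H))

variable {k H} in
theorem finiteType_coradicalSubalgebra
    (hN : IsLeftOrRightNoetherian (coradicalSubalgebra k H)) :
    Algebra.FiniteType k (coradicalSubalgebra k H) := by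
  let e := groupLikeAlgEquivCoradical k H
  have hG : Group.FG (GroupLike k H) :=
    (hN.of_surjective e.symm.toRingEquiv.toRingHom e.symm.surjective).group_fg
  exact (MonoidAlgebra.finiteType_iff_group_fg.mpr hG).equiv e

end PointedHopf

theorem corollary1p5 {k H : Type*} [Field k] [Ring H] [HopfAlgebra k H] [IsPointedCoalgebra k H]
    (hN : IsNoetherianRing (coradicalGraded k H) ∨ IsNoetherianRing (coradicalGraded k H)ᵐᵒᵖ) :
    Algebra.FiniteType k (coradicalSubalgebra k H) ∧
      Algebra.FiniteType k (coradicalGraded k H) ∧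
      Algebra.FiniteType k H := by
  have hB : (coradicalSubalgebra k H).toSubmodule = coradicalFiltration k H 0 :=
    Submodule.toSubalgebra_toSubmodule _ _ _
  let e := degreeZeroEquiv hB
  let π := e.symm.toAlgHom.comp
    (degreeZeroProjection k (GradedPiece (coradicalFiltration k H)))
  have hπ : Function.Surjective π :=
    e.symm.surjective.comp (degreeZeroProjection_surjective)
  have h0 : Algebra.FiniteType k (coradicalSubalgebra k H) :=
    finiteType_coradicalSubalgebra (IsLeftOrRightNoetherian.of_surjective hN π.toRingHom hπ)
  have hgr : Algebra.FiniteType k (coradicalGraded k H) :=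
    finiteType_directSum_of_isLeftOrRightNoetherian hN (h0.equiv e)
  exact ⟨h0, hgr, finiteType_of_finiteType_associatedGraded exists_mem_coradicalFiltration hgr⟩
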